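/- **Setting.** Let $X$ be a nonempty compact Hausdorff space, $\mathcal L_{\mathsf H}$ an arbitrary first-order language (with equality), and $\mathcal L$ a two-sorted language with a home sort $\mathsf H$ and a space sort $\mathsf S$, whose symbols are: those of $\mathcal L_{\mathsf H}$; a predicate for each closed $C\subseteq X^n$ ($n\ge 1$) and a function symbol for each continuous $f\colon X^n\to X$ ($n\ge 0$), all on sort $\mathsf S$; and an arbitrary set of function symbols of sort $\mathsf H^n\to\mathsf S$ (various $n\ge 1$). A *standard structure* is an $\mathcal L$-structure $\langle M,X\rangle$ whose $\mathsf S$-sort is $X$ with the intended interpretation; it is denoted by $M$. The class $\mathcal F$ is the least set of $\mathcal L$-formulas that contains all $\mathcal L_{\mathsf H}$-formulas and all formulas $t\in C$, with $C\subseteq X^n$ closed, $n\ge 1$, and $t$ an $n$-tuple of terms of sort $\mathsf S$ (in variables of both sorts), and is closed under $\wedge,\vee$ and under $\forall,\exists$ of both sorts. For $A\subseteq M$, $\mathcal F(A)$ is defined in the same way, allowing names for the elements of $A$. An *approximation* $\varphi'>\varphi$ of $\varphi\in\mathcal F(M)$ is a formula obtained by replacing each atomic formula $t\in C$ that occurs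 in $\varphi$ by $t\in C'$ for some closed neighbourhood $C'$ of $C$ (that is, $C'$ is closed and $C\subseteq\operatorname{int}C'$), leaving everything else unchanged. Let $\mathcal U$ be an infinite $\mathcal F$-saturated standard structure: every type $p(x;\eta)\subseteq\mathcal F(\mathcal U)$ in finite tuples of variables $x$ of sort $\mathsf H$ and $\eta$ of sort $\mathsf S$ that has fewer than $|\mathcal U|$ parameters and is finitely realized in $\mathcal U$ is realized in $\mathcal U$, where $|\mathcal U|$ is the cardinality of the home sort. For finite tuples $x,y,z$ of home variables with $|x|=|y|$, a parameter-free term $t(x,z)$ of sort $\mathsf H^{|x|+|z|}\to\mathsf S$, and $D\subseteq X\times X$, write $x\sim_{t,D}y$ for $\forall z\;\langle t(x,z),t(y,z)\rangle\in D$. Let $\Delta$ be the diagonal of $X\times X$. Write $x\sim_{\mathsf S}y$ if $x\sim_{t,\Delta}y$ for all such terms $t(x,z)$, with $|z|$ finite. For tuples $t=\langle t_1(x,z),\dots,t_k(x,z)\rangle$ of terms and $D=\langle D_1,\dots,D_k\rangle$, $k\ge1$, let $x\sim_{t,D}y$ be $\bigwedge_{i} x\sim_{t_i,D_i}y$. A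 formula $\varphi(x)$ is *$\sim_{\mathsf S}$-invariant* if $x\sim_{\mathsf S}y\to(\varphi(x)\leftrightarrow\varphi(y))$ holds in $\mathcal U$. **Proposition (Perturbation Lemma).** For every formula $\varphi(x)\in\mathcal F(\mathcal U)$, whose free variables form a finite tuple $x$ of home variables, the following are equivalent: 1. $\varphi(x)$ is $\sim_{\mathsf S}$-invariant; 2. for every $\varphi'>\varphi$ there are a finite nonempty tuple $t$ of parameter-free terms $t_i(x,z)$ of sort $\mathsf H^{|x|+|z|}\to\mathsf S$, with $z$ a finite tuple, and a tuple $D$ of the same length of closed neighbourhoods of $\Delta$ in $X\times X$, such that $$x\sim_{t,D}y\ \wedge\ \varphi(x)\ \to\ \varphi'(y)$$ holds in $\mathcal U$ for all tuples $x,y$ of elements of $\mathcal U$ of length $|x|$. -/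

import Mathlib

/-!
Throughout, `X` is a compact Hausdorff space (the space sort), `L` is the first-order language of
the home sort, and `E k` is the set of additional function symbols of sort `H ^ (k + 1) → S`.
-/

universe u v w e p h

namespace TwoSorted

open Cardinal

/-- A standard structure `⟨M, X⟩`: an `L`-structure `M` (the home sort), together with the fixed
space `X` and an interpretation of every symbol of sort `H ^ (k + 1) → S`. On the sort `X` all
symbols for closed relations and continuous functions have their intended meaning. -/
structure StandardStructure (X : Type w) (L : FirstOrder.Language.{u, v}) (E : ℕ → Type e) where
  /-- The domain of the home sort. -/
  Home : Type h
  /-- The interpretation of the home-sort language. -/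
  homeStructure : L.Structure Home
  /-- The interpretation of the symbols of sort `H ^ (k + 1) → S`. -/
  mixedMap : {k : ℕ} → E k → (Fin (k + 1) → Home) → X

attribute [instance] StandardStructure.homeStructure

/-- Terms of sort `H ^ n × S ^ m → S`, with parameters (names of home-sort elements) from `P`.
Terms without parameters are obtained with `P = Empty`. The home-sort subterms are the `L`-terms
in the names from `P` and the `n` home-sort variables. -/
inductive STerm (X : Type w) [TopologicalSpace X] (L : FirstOrder.Language.{u, v}) (E : ℕ → Type e)
    (P : Type p) (n m : ℕ) : Type (max u w e p)
  /-- A variable of the space sort. -/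
  | var (j : Fin m) : STerm X L E P n m
  /-- A continuous function `X ^ k → X` (a constant if `k = 0`), applied to terms. -/
  | func {k : ℕ} (f : C(Fin k → X, X)) (ts : Fin k → STerm X L E P n m) : STerm X L E P n m
  /-- A symbol of sort `H ^ (k + 1) → S`, applied to home-sort terms. -/
  | mixed {k : ℕ} (g : E k) (ts : Fin (k + 1) → L.Term (P ⊕ Fin n)) : STerm X L E P n m

/-- The formulas of the class `𝓕`, with parameters from `P`, whose free variables are among `n`
variables of the home sort and `m` variables of the space sort. A quantifier binds the last
variable of its sort. -/
inductive FFormula (X : Type w) [TopologicalSpace X] (L : FirstOrder.Language.{u, v}) (E : ℕ → Type e)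
    (P : Type p) : ℕ → ℕ → Type (max u v w e p)
  /-- An arbitrary first-order formula of the home-sort language. -/
  | home {n m : ℕ} (ψ : L.Formula (P ⊕ Fin n)) : FFormula X L E P n m
  /-- The formula `t ∈ C`, where `C` is a closed subset of `X ^ (k + 1)`. -/
  | mem {n m k : ℕ} (t : Fin (k + 1) → STerm X L E P n m)
      (C : TopologicalSpace.Closeds (Fin (k + 1) → X)) : FFormula X L E P n m
  | and {n m : ℕ} (φ ψ : FFormula X L E P n m) : FFormula X L E P n m
  | or {n m : ℕ} (φ ψ : FFormula X L E P n m) : FFormula X L E P n m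
  | allH {n m : ℕ} (φ : FFormula X L E P (n + 1) m) : FFormula X L E P n m
  | exH {n m : ℕ} (φ : FFormula X L E P (n + 1) m) : FFormula X L E P n m
  | allS {n m : ℕ} (φ : FFormula X L E P n (m + 1)) : FFormula X L E P n m
  | exS {n m : ℕ} (φ : FFormula X L E P n (m + 1)) : FFormula X L E P n m

section

variable {X : Type w} [TopologicalSpace X] {L : FirstOrder.Language.{u, v}} {E : ℕ → Type e} {P : Type p}

/-- The value of a term in `N`, where `c` interprets the names of the parameters. -/
def STerm.eval (N : StandardStructure.{u, v, w, e, h} X L E) (c : P → N.Home) {n m : ℕ}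
    (a : Fin n → N.Home) (α : Fin m → X) : STerm X L E P n m → X
  | .var j => α j
  | .func f ts => f fun i => (ts i).eval N c a α
  | .mixed g ts => N.mixedMap g fun i => (ts i).realize (Sum.elim c a)

/-- Satisfaction of a formula in `N`, where `c` interprets the names of the parameters. -/
def FFormula.Realize (N : StandardStructure.{u, v, w, e, h} X L E) (c : P → N.Home) :
    {n m : ℕ} → FFormula X L E P n m → (Fin n → N.Home) → (Fin m → X) → Prop
  | _, _, .home ψ, a, _ => FirstOrder.Language.Formula.Realize ψ (Sum.elim c a)
  | _, _, .mem t C, a, α => (fun i => (t i).eval N c a α) ∈ C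
  | _, _, .and φ ψ, a, α => φ.Realize N c a α ∧ ψ.Realize N c a α
  | _, _, .or φ ψ, a, α => φ.Realize N c a α ∨ ψ.Realize N c a α
  | _, _, .allH φ, a, α => ∀ b : N.Home, φ.Realize N c (Fin.snoc a b) α
  | _, _, .exH φ, a, α => ∃ b : N.Home, φ.Realize N c (Fin.snoc a b) α
  | _, _, .allS φ, a, α => ∀ β : X, φ.Realize N c a (Fin.snoc α β)
  | _, _, .exS φ, a, α => ∃ β : X, φ.Realize N c a (Fin.snoc α β)

open Classical in
/-- The parameters that occur in a term. -/
def STerm.params {n m : ℕ} : STerm X L E P n m → Set P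
  | .var _ => ∅
  | .func _ ts => ⋃ i, (ts i).params
  | .mixed _ ts => ⋃ i, {q | Sum.inl q ∈ (ts i).varFinset}

open Classical in
/-- The parameters that occur in a formula. -/
def FFormula.params : {n m : ℕ} → FFormula X L E P n m → Set P
  | _, _, .home ψ => {q | Sum.inl q ∈ FirstOrder.Language.BoundedFormula.freeVarFinset ψ}
  | _, _, .mem t _ => ⋃ i, (t i).params
  | _, _, .and φ ψ => φ.params ∪ ψ.params
  | _, _, .or φ ψ => φ.params ∪ ψ.params
  | _, _, .allH φ => φ.params
  | _, _, .exH φ => φ.params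
  | _, _, .allS φ => φ.params
  | _, _, .exS φ => φ.params

/-- `FFormula.Approx φ φ'` says that `φ' > φ`: each atomic formula `t ∈ C` occurring in `φ` is
replaced by `t ∈ C'` for some closed neighbourhood `C'` of `C`. -/
inductive FFormula.Approx : {n m : ℕ} → FFormula X L E P n m → FFormula X L E P n m → Prop
  | home {n m : ℕ} (ψ : L.Formula (P ⊕ Fin n)) :
      FFormula.Approx (.home ψ : FFormula X L E P n m) (.home ψ)
  | mem {n m k : ℕ} (t : Fin (k + 1) → STerm X L E P n m)
      {C C' : TopologicalSpace.Closeds (Fin (k + 1) → X)}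
      (hC : (C : Set (Fin (k + 1) → X)) ⊆ interior (C' : Set (Fin (k + 1) → X))) :
      FFormula.Approx (.mem t C) (.mem t C')
  | and {n m : ℕ} {φ φ' ψ ψ' : FFormula X L E P n m} (hφ : FFormula.Approx φ φ')
      (hψ : FFormula.Approx ψ ψ') : FFormula.Approx (.and φ ψ) (.and φ' ψ')
  | or {n m : ℕ} {φ φ' ψ ψ' : FFormula X L E P n m} (hφ : FFormula.Approx φ φ')
      (hψ : FFormula.Approx ψ ψ') : FFormula.Approx (.or φ ψ) (.or φ' ψ')
  | allH {n m : ℕ} {φ φ' : FFormula X L E P (n + 1) m} (hφ : FFormula.Approx φ φ') :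
      FFormula.Approx (.allH φ) (.allH φ')
  | exH {n m : ℕ} {φ φ' : FFormula X L E P (n + 1) m} (hφ : FFormula.Approx φ φ') :
      FFormula.Approx (.exH φ) (.exH φ')
  | allS {n m : ℕ} {φ φ' : FFormula X L E P n (m + 1)} (hφ : FFormula.Approx φ φ') :
      FFormula.Approx (.allS φ) (.allS φ')
  | exS {n m : ℕ} {φ φ' : FFormula X L E P n (m + 1)} (hφ : FFormula.Approx φ φ') :
      FFormula.Approx (.exS φ) (.exS φ')

namespace StandardStructure

/-- The formulas of `𝓕(N)`: their parameters are elements of `N`. -/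
abbrev Formula (N : StandardStructure.{u, v, w, e, h} X L E) (n m : ℕ) :=
  FFormula X L E N.Home n m

/-- Satisfaction of a formula of `𝓕(N)` in `N`: every parameter names itself. -/
def Sat (N : StandardStructure.{u, v, w, e, h} X L E) {n m : ℕ} (φ : N.Formula n m)
    (a : Fin n → N.Home) (α : Fin m → X) : Prop :=
  φ.Realize N id a α

/-- `N` is `κ`-`𝓕`-saturated: every type `p(x; η) ⊆ 𝓕(N)` in finitely many variables that has
fewer than `κ` parameters and is finitely realized in `N` is realized in `N`. -/
def IsFSaturatedIn (N : StandardStructure.{u, v, w, e, h} X L E) (κ : Cardinal.{h}) : Prop :=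
  ∀ (n m : ℕ) (T : Set (N.Formula n m)),
    #(⋃ φ ∈ T, φ.params : Set N.Home) < κ →
    (∀ T₀ ⊆ T, T₀.Finite → ∃ a α, ∀ φ ∈ T₀, N.Sat φ a α) →
    ∃ a α, ∀ φ ∈ T, N.Sat φ a α

/-- `N` is `𝓕`-saturated: it is `κ`-`𝓕`-saturated where `κ` is its own cardinality. -/
def IsFSaturated (N : StandardStructure.{u, v, w, e, h} X L E) : Prop :=
  N.IsFSaturatedIn #N.Home

/-- The relation `x ∼_{t,D} y` in `N`: truth of the formula `∀ z, ⟨t(x, z), t(y, z)⟩ ∈ D`, for a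
parameter-free term `t(x, z)` of sort `H ^ (n + l) → S`. -/
def SimTerm (N : StandardStructure.{u, v, w, e, h} X L E) {n l : ℕ}
    (t : STerm X L E Empty (n + l) 0) (D : Set (X × X)) (a b : Fin n → N.Home) : Prop :=
  ∀ z : Fin l → N.Home,
    (t.eval N Empty.elim (Fin.append a z) Fin.elim0,
      t.eval N Empty.elim (Fin.append b z) Fin.elim0) ∈ D

/-- The relation `x ∼_S y` in `N`: `x ∼_{t,Δ} y` for all parameter-free terms `t(x, z)` of sort
`H ^ (n + l) → S`, where `Δ` is the diagonal of `X × X`. -/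
def SimS (N : StandardStructure.{u, v, w, e, h} X L E) {n : ℕ} (a b : Fin n → N.Home) : Prop :=
  ∀ (l : ℕ) (t : STerm X L E Empty (n + l) 0), N.SimTerm t (Set.diagonal X) a b

/-- The formula `φ(x)` is `∼_S`-invariant. -/
def IsSimSInvariant (N : StandardStructure.{u, v, w, e, h} X L E) {n : ℕ} (φ : N.Formula n 0) :
    Prop :=
  ∀ a b : Fin n → N.Home, N.SimS a b → (N.Sat φ a Fin.elim0 ↔ N.Sat φ b Fin.elim0)

end StandardStructure

end

end TwoSorted

/-!
Two facts about the class `𝓕` carry the proof.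

* In an `𝓕`-saturated infinite structure a formula holds as soon as all its approximations hold
  (`IsFSaturated.sat_of_forall_approx`). For atomic formulas this is normality of the compact
  Hausdorff space `X ^ (k + 1)`. At an existential quantifier, the approximations of the formula
  below it are directed, hence form a finitely realized type, and saturation provides the witness.
  Since `x ∼_S y` implies every `x ∼_{t,D} y`, the second condition therefore implies the first.
* The class `𝓕` has no negation, but any `φ' > φ` comes with a formula `ψ` of `𝓕` that is
  inconsistent with `φ` and such that `φ' ∨ ψ` is valid (`FFormula.Approx.exists_separating`):
  dualize `φ` and replace each atomic formula `t ∈ C` by `t ∉ interior C'`.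

For the other implication, the sets of pairs that contain a basic relation `x ∼_{t,D} y` form a
filter, and the second condition says that `φ(x) → φ'(y)` holds eventually along it. If this failed,
`φ(x)`, `ψ(y)` and all the formulas `x ∼_{t,D} y` would be a finitely realized type whose only
parameters are those of `φ(x)` and `ψ(y)`. A realization satisfies `x ∼_S y`, as the closed
neighbourhoods of the diagonal intersect in the diagonal, and it contradicts the invariance
of `φ`.
-/

namespace TwoSorted

open Cardinal Filter

section

variable {X : Type w} [TopologicalSpace X] {L : FirstOrder.Language.{u, v}} {E : ℕ → Type e}
  {P : Type p}

/-! ### Finiteness of the set of parameters -/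

theorem STerm.finite_params {n m : ℕ} (t : STerm X L E P n m) : t.params.Finite := by
  classical
  induction t with
  | var j => exact Set.finite_empty
  | func f ts ih => exact Set.finite_iUnion ih
  | mixed g ts =>
    refine Set.finite_iUnion fun i => ?_
    exact Set.Finite.preimage Sum.inl_injective.injOn (Finset.finite_toSet _)

theorem FFormula.finite_params {n m : ℕ} (φ : FFormula X L E P n m) : φ.params.Finite := by
  classical
  induction φ with
  | home ψ => exact Set.Finite.preimage Sum.inl_injective.injOn (Finset.finite_toSet _)
  | mem t C => exact Set.finite_iUnion fun i => (t i).finite_params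
  | and φ ψ h₁ h₂ => exact h₁.union h₂
  | or φ ψ h₁ h₂ => exact h₁.union h₂
  | allH φ ih => exact ih
  | exH φ ih => exact ih
  | allS φ ih => exact ih
  | exS φ ih => exact ih

theorem FFormula.Approx.params_eq {n m : ℕ} {φ φ' : FFormula X L E P n m} (hφ : φ.Approx φ') :
    φ'.params = φ.params := by
  induction hφ with
  | home ψ => rfl
  | mem t hC => rfl
  | and _ _ h₁ h₂ => simp only [FFormula.params, h₁, h₂]
  | or _ _ h₁ h₂ => simp only [FFormula.params, h₁, h₂]
  | allH _ ih => exact ih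
  | exH _ ih => exact ih
  | allS _ ih => exact ih
  | exS _ ih => exact ih

/-! ### Renaming of home variables -/

/-- Renaming of the home-sort variables of a term by `f`, and of its parameters by `g`. -/
def STerm.map {P' : Type*} {n n' m : ℕ} (f : Fin n → Fin n') (g : P → P') :
    STerm X L E P n m → STerm X L E P' n' m
  | .var j => .var j
  | .func F ts => .func F fun i => (ts i).map f g
  | .mixed G ts => .mixed G fun i => (ts i).relabel (Sum.map g f)

theorem STerm.eval_map (N : StandardStructure.{u, v, w, e, h} X L E) {P' : Type*} {n n' m : ℕ}
    (f : Fin n → Fin n') (g : P → P') (c : P' → N.Home) (a : Fin n' → N.Home) (α : Fin m → X)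
    (t : STerm X L E P n m) : (t.map f g).eval N c a α = t.eval N (c ∘ g) (a ∘ f) α := by
  induction t with
  | var j => rfl
  | func F ts ih => simp only [STerm.map, STerm.eval, ih]
  | mixed G ts =>
    simp only [STerm.map, STerm.eval, FirstOrder.Language.Term.realize_relabel,
      Sum.elim_comp_map]

theorem STerm.params_map_empty {P' : Type*} {n n' m : ℕ} (f : Fin n → Fin n') (g : Empty → P')
    (t : STerm X L E Empty n m) : (t.map f g).params = ∅ := by
  classical
  induction t with
  | var j => rfl
  | func F ts ih => simpa only [STerm.map, STerm.params, Set.iUnion_eq_empty] using ih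
  | mixed G ts =>
    simp only [STerm.map, STerm.params, Set.iUnion_eq_empty]
    intro i
    generalize ts i = s
    induction s with
    | var x =>
      rcases x with x | x
      · exact x.elim
      · ext q
        simp [FirstOrder.Language.Term.relabel, FirstOrder.Language.Term.varFinset]
    | func F ss ih =>
      simp only [Set.eq_empty_iff_forall_notMem, Set.mem_ofPred_eq] at ih ⊢
      intro q hq
      simp only [FirstOrder.Language.Term.relabel, FirstOrder.Language.Term.varFinset,
        Finset.mem_biUnion] at hq
      obtain ⟨j, -, hj⟩ := hq
      exact ih j q hj

/-- The extension of a renaming of variables that fixes a further, last variable. -/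
def liftRenaming {n n' : ℕ} (f : Fin n → Fin n') : Fin (n + 1) → Fin (n' + 1) :=
  Fin.snoc (α := fun _ => Fin (n' + 1)) (fun i => (f i).castSucc) (Fin.last n')

theorem snoc_comp_liftRenaming {A : Type*} {n n' : ℕ} (f : Fin n → Fin n') (a : Fin n' → A)
    (b : A) : (Fin.snoc (α := fun _ => A) a b) ∘ liftRenaming f =
      Fin.snoc (α := fun _ => A) (a ∘ f) b := by
  ext i
  refine Fin.lastCases ?_ (fun i => ?_) i <;> simp [liftRenaming]

/-- Renaming of the free home-sort variables of a formula. -/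
def FFormula.rename {n n' m : ℕ} (f : Fin n → Fin n') :
    FFormula X L E P n m → FFormula X L E P n' m
  | .home ψ => .home (ψ.relabel (Sum.map id f))
  | .mem t C => .mem (fun i => (t i).map f id) C
  | .and φ ψ => .and (φ.rename f) (ψ.rename f)
  | .or φ ψ => .or (φ.rename f) (ψ.rename f)
  | .allH φ => .allH (φ.rename (liftRenaming f))
  | .exH φ => .exH (φ.rename (liftRenaming f))
  | .allS φ => .allS (φ.rename f)
  | .exS φ => .exS (φ.rename f)

theorem FFormula.realize_rename (N : StandardStructure.{u, v, w, e, h} X L E) (c : P → N.Home)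
    {n m : ℕ} (φ : FFormula X L E P n m) : ∀ {n' : ℕ} (f : Fin n → Fin n') (a : Fin n' → N.Home)
    (α : Fin m → X), (φ.rename f).Realize N c a α ↔ φ.Realize N c (a ∘ f) α := by
  induction φ with
  | home ψ =>
    intro n' f a α
    simp only [FFormula.rename, FFormula.Realize, FirstOrder.Language.Formula.realize_relabel,
      Sum.elim_comp_map, Function.comp_id]
  | mem t C =>
    intro n' f a α
    simp only [FFormula.rename, FFormula.Realize, STerm.eval_map, Function.comp_id]
  | and φ ψ h₁ h₂ => intro n' f a α; simp only [FFormula.rename, FFormula.Realize, h₁, h₂]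
  | or φ ψ h₁ h₂ => intro n' f a α; simp only [FFormula.rename, FFormula.Realize, h₁, h₂]
  | allH φ ih =>
    intro n' f a α
    simp only [FFormula.rename, FFormula.Realize, ih, snoc_comp_liftRenaming]
  | exH φ ih =>
    intro n' f a α
    simp only [FFormula.rename, FFormula.Realize, ih, snoc_comp_liftRenaming]
  | allS φ ih => intro n' f a α; simp only [FFormula.rename, FFormula.Realize, ih]
  | exS φ ih => intro n' f a α; simp only [FFormula.rename, FFormula.Realize, ih]

/-! ### Approximations -/

theorem FFormula.exists_approx {n m : ℕ} (φ : FFormula X L E P n m) : ∃ φ', φ.Approx φ' := by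
  induction φ with
  | home ψ => exact ⟨_, .home ψ⟩
  | mem t C => exact ⟨_, .mem t (C' := ⊤) (by simp)⟩
  | and φ ψ h₁ h₂ => exact ⟨_, .and h₁.choose_spec h₂.choose_spec⟩
  | or φ ψ h₁ h₂ => exact ⟨_, .or h₁.choose_spec h₂.choose_spec⟩
  | allH φ ih => exact ⟨_, .allH ih.choose_spec⟩
  | exH φ ih => exact ⟨_, .exH ih.choose_spec⟩
  | allS φ ih => exact ⟨_, .allS ih.choose_spec⟩
  | exS φ ih => exact ⟨_, .exS ih.choose_spec⟩

/-- The approximations of a formula are directed: any two have a common strengthening, obtained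
by intersecting the closed neighbourhoods. -/
theorem FFormula.Approx.exists_le (N : StandardStructure.{u, v, w, e, h} X L E) (c : P → N.Home)
    {n m : ℕ} {φ φ₁ φ₂ : FFormula X L E P n m} (h₁ : φ.Approx φ₁) (h₂ : φ.Approx φ₂) :
    ∃ φ₃, φ.Approx φ₃ ∧
      ∀ a α, φ₃.Realize N c a α → φ₁.Realize N c a α ∧ φ₂.Realize N c a α := by
  induction h₁ with
  | home ψ => cases h₂; exact ⟨_, .home ψ, fun a α H => ⟨H, H⟩⟩
  | mem t hC =>
    rename_i C C₁
    cases h₂ with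
    | mem _ hC₂ =>
      rename_i C₂
      refine ⟨_, .mem t (C' := C₁ ⊓ C₂) ?_, fun a α H => H⟩
      rw [TopologicalSpace.Closeds.coe_inf, interior_inter]
      exact Set.subset_inter hC hC₂
  | and _ _ ih ih' =>
    cases h₂ with
    | and hφ hψ =>
      obtain ⟨χ, hχ, H⟩ := ih hφ
      obtain ⟨χ', hχ', H'⟩ := ih' hψ
      exact ⟨_, .and hχ hχ', fun a α K =>
        ⟨⟨(H _ _ K.1).1, (H' _ _ K.2).1⟩, ⟨(H _ _ K.1).2, (H' _ _ K.2).2⟩⟩⟩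
  | or _ _ ih ih' =>
    cases h₂ with
    | or hφ hψ =>
      obtain ⟨χ, hχ, H⟩ := ih hφ
      obtain ⟨χ', hχ', H'⟩ := ih' hψ
      exact ⟨_, .or hχ hχ', fun a α K =>
        ⟨K.imp (fun k => (H _ _ k).1) (fun k => (H' _ _ k).1),
          K.imp (fun k => (H _ _ k).2) (fun k => (H' _ _ k).2)⟩⟩
  | allH _ ih =>
    cases h₂ with
    | allH hφ =>
      obtain ⟨χ, hχ, H⟩ := ih hφ
      exact ⟨_, .allH hχ, fun a α K => ⟨fun b => (H _ _ (K b)).1, fun b => (H _ _ (K b)).2⟩⟩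
  | exH _ ih =>
    cases h₂ with
    | exH hφ =>
      obtain ⟨χ, hχ, H⟩ := ih hφ
      exact ⟨_, .exH hχ, fun a α ⟨b, K⟩ => ⟨⟨b, (H _ _ K).1⟩, ⟨b, (H _ _ K).2⟩⟩⟩
  | allS _ ih =>
    cases h₂ with
    | allS hφ =>
      obtain ⟨χ, hχ, H⟩ := ih hφ
      exact ⟨_, .allS hχ, fun a α K => ⟨fun b => (H _ _ (K b)).1, fun b => (H _ _ (K b)).2⟩⟩
  | exS _ ih =>
    cases h₂ with
    | exS hφ =>
      obtain ⟨χ, hχ, H⟩ := ih hφ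
      exact ⟨_, .exS hχ, fun a α ⟨b, K⟩ => ⟨⟨b, (H _ _ K).1⟩, ⟨b, (H _ _ K).2⟩⟩⟩

theorem FFormula.exists_approx_le_of_finite (N : StandardStructure.{u, v, w, e, h} X L E)
    (c : P → N.Home) {n m : ℕ} (φ : FFormula X L E P n m) {T : Set (FFormula X L E P n m)}
    (hT : T.Finite) : (∀ ψ ∈ T, φ.Approx ψ) →
      ∃ χ, φ.Approx χ ∧ ∀ a α, χ.Realize N c a α → ∀ ψ ∈ T, ψ.Realize N c a α := by
  induction T, hT using Set.Finite.induction_on with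
  | empty =>
    intro _
    obtain ⟨χ, hχ⟩ := φ.exists_approx
    exact ⟨χ, hχ, by simp⟩
  | insert _ _ ih =>
    intro hT
    obtain ⟨χ, hχ, H⟩ := ih fun ψ hψ => hT ψ (Set.mem_insert_of_mem _ hψ)
    obtain ⟨χ', hχ', H'⟩ := (hT _ (Set.mem_insert _ _)).exists_le N c hχ
    refine ⟨χ', hχ', fun a α K ψ hψ => ?_⟩
    rcases hψ with rfl | hψ
    · exact (H' a α K).1
    · exact H a α (H' a α K).2 ψ hψ

/-- For `φ' > φ` there is a formula of `𝓕` that is weaker than `¬ φ'` and stronger than `¬ φ`. It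
replaces negation, under which `𝓕` is not closed. -/
theorem FFormula.Approx.exists_separating (N : StandardStructure.{u, v, w, e, h} X L E)
    (c : P → N.Home) {n m : ℕ} {φ φ' : FFormula X L E P n m} (hφ : φ.Approx φ') :
    ∃ ψ : FFormula X L E P n m, ∀ a α,
      (φ.Realize N c a α → ¬ ψ.Realize N c a α) ∧ (¬ φ'.Realize N c a α → ψ.Realize N c a α) := by
  induction hφ with
  | home ψ =>
    refine ⟨.home ψ.not, fun a α => ?_⟩
    simp only [FFormula.Realize, FirstOrder.Language.Formula.realize_not, not_not, imp_self,
      and_self]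
  | mem t hC =>
    rename_i C C'
    exact ⟨.mem t ⟨(interior (C' : Set _))ᶜ, isOpen_interior.isClosed_compl⟩, fun a α =>
      ⟨fun h₁ h₂ => h₂ (hC h₁), fun h₁ h₂ => h₁ (interior_subset h₂)⟩⟩
  | and _ _ ih ih' =>
    obtain ⟨χ, H⟩ := ih
    obtain ⟨χ', H'⟩ := ih'
    refine ⟨.or χ χ', fun a α => ⟨fun h => not_or.2 ⟨(H a α).1 h.1, (H' a α).1 h.2⟩, fun h => ?_⟩⟩
    exact (not_and_or.1 h).imp (H a α).2 (H' a α).2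
  | or _ _ ih ih' =>
    obtain ⟨χ, H⟩ := ih
    obtain ⟨χ', H'⟩ := ih'
    refine ⟨.and χ χ', fun a α => ⟨fun h hχ => ?_, fun h => ?_⟩⟩
    · exact h.elim (fun k => (H a α).1 k hχ.1) (fun k => (H' a α).1 k hχ.2)
    · exact ⟨(H a α).2 fun k => h (Or.inl k), (H' a α).2 fun k => h (Or.inr k)⟩
  | allH _ ih =>
    obtain ⟨χ, H⟩ := ih
    refine ⟨.exH χ, fun a α => ⟨fun h₁ ⟨b, hb⟩ => (H _ _).1 (h₁ b) hb, fun h₁ => ?_⟩⟩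
    obtain ⟨b, hb⟩ := not_forall.1 h₁
    exact ⟨b, (H _ _).2 hb⟩
  | exH _ ih =>
    obtain ⟨χ, H⟩ := ih
    exact ⟨.allH χ, fun a α => ⟨fun ⟨b, hb⟩ h₁ => (H _ _).1 hb (h₁ b),
      fun h₁ b => (H _ _).2 fun hb => h₁ ⟨b, hb⟩⟩⟩
  | allS _ ih =>
    obtain ⟨χ, H⟩ := ih
    refine ⟨.exS χ, fun a α => ⟨fun h₁ ⟨b, hb⟩ => (H _ _).1 (h₁ b) hb, fun h₁ => ?_⟩⟩
    obtain ⟨b, hb⟩ := not_forall.1 h₁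
    exact ⟨b, (H _ _).2 hb⟩
  | exS _ ih =>
    obtain ⟨χ, H⟩ := ih
    exact ⟨.allS χ, fun a α => ⟨fun ⟨b, hb⟩ h₁ => (H _ _).1 hb (h₁ b),
      fun h₁ b => (H _ _).2 fun hb => h₁ ⟨b, hb⟩⟩⟩

end

section

variable {X : Type w} [TopologicalSpace X] {L : FirstOrder.Language.{u, v}} {E : ℕ → Type e}

/-! ### Saturation and approximations -/

/-- In a normal space, a point that lies in all closed neighbourhoods of a closed set lies in the
set. -/
theorem mem_of_forall_closed_nhds {Y : Type*} [TopologicalSpace Y] [NormalSpace Y] [T1Space Y]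
    {C : Set Y} (hC : IsClosed C) {y : Y}
    (hy : ∀ D : Set Y, IsClosed D → C ⊆ interior D → y ∈ D) : y ∈ C := by
  by_contra hyC
  obtain ⟨V, hV, hCV, hVy⟩ := normal_exists_closure_subset hC (isOpen_compl_singleton (x := y))
    (fun z hz hzy => hyC (Set.mem_singleton_iff.1 hzy ▸ hz))
  exact hVy (hy (closure V) isClosed_closure
    (hCV.trans (interior_maximal subset_closure hV))) rfl

/-- Saturation applied to the type of all approximations of `φ`, with some coordinates held fixed;
it is finitely realized because the approximations are directed. If every approximation of `φ` is
realized by a tuple whose coordinates along `f` and `g` are `a` and `α`, then a single such tuple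
realizes all approximations of `φ`. -/
theorem StandardStructure.IsFSaturated.exists_forall_approx [T1Space X]
    {U : StandardStructure.{u, v, w, e, h} X L E} (hU : U.IsFSaturated) (hInf : Infinite U.Home)
    {n m n' m' : ℕ} (φ : U.Formula n' m') (f : Fin n → Fin n') (g : Fin m → Fin m')
    (a : Fin n → U.Home) (α : Fin m → X)
    (H : ∀ φ', φ.Approx φ' → ∃ b β, b ∘ f = a ∧ β ∘ g = α ∧ U.Sat φ' b β) :
    ∃ b β, b ∘ f = a ∧ β ∘ g = α ∧ ∀ φ', φ.Approx φ' → U.Sat φ' b β := by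
  -- The values `a` and `α` are prescribed by the formulas `x = a` and `η ∈ {α}`.
  let eqH : Fin n → U.Formula n' m' := fun i => .home
    (FirstOrder.Language.Term.equal (FirstOrder.Language.Term.var (Sum.inr (f i)))
      (FirstOrder.Language.Term.var (Sum.inl (a i))))
  let eqS : Fin m → U.Formula n' m' := fun j =>
    .mem (k := 0) (fun _ => .var (g j)) ⟨{fun _ => α j}, isClosed_singleton⟩
  have sat_eqH : ∀ i b β, U.Sat (eqH i) b β ↔ b (f i) = a i := by
    intro i b β
    simp [eqH, StandardStructure.Sat, FFormula.Realize]
  have sat_eqS : ∀ j b β, U.Sat (eqS j) b β ↔ β (g j) = α j := by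
    intro j b β
    change (fun _ : Fin (0 + 1) => β (g j)) = (fun _ => α j) ↔ _
    exact ⟨fun h => congrFun h 0, fun h => funext fun _ => h⟩
  have hcard : #(⋃ ψ ∈ {φ' | φ.Approx φ'} ∪ (Set.range eqH ∪ Set.range eqS),
      ψ.params : Set U.Home) < #U.Home := by
    refine lt_of_lt_of_le (Cardinal.lt_aleph0_iff_set_finite.2 ?_) (Cardinal.aleph0_le_mk U.Home)
    rw [Set.biUnion_union]
    refine Set.Finite.union (φ.finite_params.subset ?_) ?_
    · exact Set.iUnion₂_subset fun φ' hφ' => (FFormula.Approx.params_eq hφ').le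
    · exact ((Set.finite_range eqH).union (Set.finite_range eqS)).biUnion
        fun ψ _ => ψ.finite_params
  have hfin : ∀ T₀ ⊆ {φ' | φ.Approx φ'} ∪ (Set.range eqH ∪ Set.range eqS), T₀.Finite →
      ∃ a α, ∀ ψ ∈ T₀, U.Sat ψ a α := by
    intro T₀ hT₀ hfin
    obtain ⟨χ, hχ, Hχ⟩ := φ.exists_approx_le_of_finite U id
      (hfin.inter_of_left {φ' | φ.Approx φ'}) fun ψ hψ => hψ.2
    obtain ⟨b, β, hba, hβα, hbβ⟩ := H χ hχ
    refine ⟨b, β, fun ψ hψ => ?_⟩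
    rcases hT₀ hψ with h | ⟨i, rfl⟩ | ⟨j, rfl⟩
    · exact Hχ b β hbβ ψ ⟨hψ, h⟩
    · exact (sat_eqH i b β).2 (congrFun hba i)
    · exact (sat_eqS j b β).2 (congrFun hβα j)
  obtain ⟨b, β, hb⟩ := hU n' m' ({φ' | φ.Approx φ'} ∪ (Set.range eqH ∪ Set.range eqS)) hcard hfin
  refine ⟨b, β, funext fun i => ?_, funext fun j => ?_, fun φ' hφ' => hb φ' (Or.inl hφ')⟩
  · exact (sat_eqH i b β).1 (hb _ (Or.inr (Or.inl ⟨i, rfl⟩)))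
  · exact (sat_eqS j b β).1 (hb _ (Or.inr (Or.inr ⟨j, rfl⟩)))

/-- In an infinite `𝓕`-saturated structure, a formula is equivalent to the conjunction of its
approximations. -/
theorem StandardStructure.IsFSaturated.sat_of_forall_approx [CompactSpace X] [T2Space X]
    {U : StandardStructure.{u, v, w, e, h} X L E} (hU : U.IsFSaturated) (hInf : Infinite U.Home)
    {n m : ℕ} (φ : U.Formula n m) : ∀ (a : Fin n → U.Home) (α : Fin m → X),
      (∀ φ', φ.Approx φ' → U.Sat φ' a α) → U.Sat φ a α := by
  induction φ with
  | home ψ => exact fun a α H => H _ (.home ψ)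
  | mem t C =>
    intro a α H
    refine mem_of_forall_closed_nhds C.isClosed fun D hD hCD => ?_
    exact H _ (.mem t (C' := ⟨D, hD⟩) hCD)
  | and φ ψ h₁ h₂ =>
    intro a α H
    obtain ⟨φ₀, hφ₀⟩ := φ.exists_approx
    obtain ⟨ψ₀, hψ₀⟩ := ψ.exists_approx
    exact ⟨h₁ a α fun φ' hφ' => (H _ (.and hφ' hψ₀)).1,
      h₂ a α fun ψ' hψ' => (H _ (.and hφ₀ hψ')).2⟩
  | or φ ψ h₁ h₂ =>
    intro a α H
    by_contra hne
    obtain ⟨hφ, hψ⟩ := not_or.1 hne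
    obtain ⟨φ', hφ', nφ'⟩ : ∃ φ', φ.Approx φ' ∧ ¬ U.Sat φ' a α := by
      by_contra! K
      exact hφ (h₁ a α K)
    obtain ⟨ψ', hψ', nψ'⟩ : ∃ ψ', ψ.Approx ψ' ∧ ¬ U.Sat ψ' a α := by
      by_contra! K
      exact hψ (h₂ a α K)
    exact (H _ (.or hφ' hψ')).elim nφ' nψ'
  | allH φ ih => exact fun a α H b => ih _ _ fun φ' hφ' => H _ (.allH hφ') b
  | allS φ ih => exact fun a α H b => ih _ _ fun φ' hφ' => H _ (.allS hφ') b
  | exH φ ih =>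
    intro a α H
    have hreal : ∀ φ', φ.Approx φ' →
        ∃ b β, b ∘ Fin.castSucc = a ∧ β ∘ id = α ∧ U.Sat φ' b β := by
      intro φ' hφ'
      obtain ⟨b, hb⟩ := H _ (.exH hφ')
      exact ⟨Fin.snoc (α := fun _ => U.Home) a b, α,
        funext fun i => Fin.snoc_castSucc (α := fun _ => U.Home) _ _ i, rfl, hb⟩
    obtain ⟨b, β, rfl, rfl, hbβ⟩ := hU.exists_forall_approx hInf φ Fin.castSucc id a α hreal
    refine ⟨b (Fin.last _), ?_⟩
    have hb : Fin.snoc (α := fun _ => U.Home) (b ∘ Fin.castSucc) (b (Fin.last _)) = b :=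
      Fin.snoc_init_self b
    rw [hb]
    exact ih _ _ hbβ
  | exS φ ih =>
    intro a α H
    have hreal : ∀ φ', φ.Approx φ' →
        ∃ b β, b ∘ id = a ∧ β ∘ Fin.castSucc = α ∧ U.Sat φ' b β := by
      intro φ' hφ'
      obtain ⟨β, hβ⟩ := H _ (.exS hφ')
      exact ⟨a, Fin.snoc (α := fun _ => X) α β, rfl,
        funext fun i => Fin.snoc_castSucc (α := fun _ => X) _ _ i, hβ⟩
    obtain ⟨b, β, rfl, rfl, hbβ⟩ := hU.exists_forall_approx hInf φ id Fin.castSucc a α hreal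
    refine ⟨β (Fin.last _), ?_⟩
    have hβ : Fin.snoc (α := fun _ => X) (β ∘ Fin.castSucc) (β (Fin.last _)) = β :=
      Fin.snoc_init_self β
    rw [hβ]
    exact ih _ _ hbβ

/-! ### The relations `x ∼_{t,D} y` -/

/-- Universal quantification over the last `l` home-sort variables. -/
def FFormula.allHs {P : Type p} {n m : ℕ} :
    (l : ℕ) → FFormula X L E P (n + l) m → FFormula X L E P n m
  | 0, φ => φ
  | l + 1, φ => FFormula.allHs l (.allH φ)

theorem FFormula.params_allHs {P : Type p} {n m : ℕ} : ∀ (l : ℕ)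
    (φ : FFormula X L E P (n + l) m), (FFormula.allHs l φ).params = φ.params
  | 0, _ => rfl
  | l + 1, φ => FFormula.params_allHs l (.allH φ)

theorem FFormula.realize_allHs {P : Type p} (N : StandardStructure.{u, v, w, e, h} X L E)
    (c : P → N.Home) {n m : ℕ} (a : Fin n → N.Home) (α : Fin m → X) :
    ∀ (l : ℕ) (φ : FFormula X L E P (n + l) m), (FFormula.allHs l φ).Realize N c a α ↔
      ∀ z : Fin l → N.Home, φ.Realize N c (Fin.append a z) α
  | 0, φ => by
    have key : ∀ z : Fin 0 → N.Home, Fin.append a z = a := fun z => by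
      rw [Subsingleton.elim z Fin.elim0, Fin.append_elim0]
      rfl
    simp only [key, FFormula.allHs, forall_const]
  | l + 1, φ => by
    rw [FFormula.allHs, FFormula.realize_allHs N c a α l]
    simp only [FFormula.Realize]
    constructor
    · intro H z
      have := H (Fin.init z) (z (Fin.last l))
      rwa [← Fin.append_snoc, Fin.snoc_init_self] at this
    · intro H z b
      rw [← Fin.append_snoc]
      exact H _

theorem append_comp_castAdd {A : Type*} {m n : ℕ} (a : Fin m → A) (b : Fin n → A) :
    Fin.append a b ∘ Fin.castAdd n = a :=
  funext fun i => Fin.append_left a b i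

theorem append_comp_natAdd {A : Type*} {m n : ℕ} (a : Fin m → A) (b : Fin n → A) :
    Fin.append a b ∘ Fin.natAdd m = b :=
  funext fun i => Fin.append_right a b i

/-- The renaming of variables that turns a term `t(x, z)` into `t(x, z)` as a term
in `x, y, z`. -/
def leftVars (n l : ℕ) : Fin (n + l) → Fin (n + n + l) :=
  Fin.append (fun i => Fin.castAdd l (Fin.castAdd n i)) (Fin.natAdd (n + n))

/-- The renaming of variables that turns a term `t(x, z)` into `t(y, z)` as a term
in `x, y, z`. -/
def rightVars (n l : ℕ) : Fin (n + l) → Fin (n + n + l) :=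
  Fin.append (fun i => Fin.castAdd l (Fin.natAdd n i)) (Fin.natAdd (n + n))

theorem append_append_comp_leftVars {A : Type*} {n l : ℕ} (a b : Fin n → A) (z : Fin l → A) :
    Fin.append (Fin.append a b) z ∘ leftVars n l = Fin.append a z := by
  ext i
  refine Fin.addCases (fun i => ?_) (fun i => ?_) i <;> simp [leftVars]

theorem append_append_comp_rightVars {A : Type*} {n l : ℕ} (a b : Fin n → A) (z : Fin l → A) :
    Fin.append (Fin.append a b) z ∘ rightVars n l = Fin.append b z := by
  ext i
  refine Fin.addCases (fun i => ?_) (fun i => ?_) i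
  · simp only [rightVars, Function.comp_apply, Fin.append_left, Fin.append_right]
  · simp only [rightVars, Function.comp_apply, Fin.append_right]

/-- The formula `x ∼_{t,D} y` of `𝓕`, in the `n + n` variables `x, y`. -/
def simFormula {P : Type p} {n l : ℕ} (t : STerm X L E Empty (n + l) 0)
    (D : TopologicalSpace.Closeds (X × X)) : FFormula X L E P (n + n) 0 :=
  FFormula.allHs l (.mem (k := 1)
    ![t.map (leftVars n l) Empty.elim, t.map (rightVars n l) Empty.elim]
    ⟨(fun s : Fin 2 → X => (s 0, s 1)) ⁻¹' D, D.isClosed.preimage (by fun_prop)⟩)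

theorem params_simFormula {P : Type p} {n l : ℕ} (t : STerm X L E Empty (n + l) 0)
    (D : TopologicalSpace.Closeds (X × X)) :
    (simFormula t D : FFormula X L E P (n + n) 0).params = ∅ := by
  rw [simFormula, FFormula.params_allHs, FFormula.params, Set.iUnion_eq_empty]
  intro i
  fin_cases i <;> exact STerm.params_map_empty _ _ _

theorem sat_simFormula (N : StandardStructure.{u, v, w, e, h} X L E) {n l : ℕ}
    (t : STerm X L E Empty (n + l) 0) (D : TopologicalSpace.Closeds (X × X))
    (a b : Fin n → N.Home) :
    N.Sat (simFormula t D) (Fin.append a b) Fin.elim0 ↔ N.SimTerm t D a b := by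
  rw [StandardStructure.Sat, simFormula, FFormula.realize_allHs]
  refine forall_congr' fun z => ?_
  change ((t.map (leftVars n l) Empty.elim).eval N id _ _,
    (t.map (rightVars n l) Empty.elim).eval N id _ _) ∈ (D : Set (X × X)) ↔ _
  rw [STerm.eval_map, STerm.eval_map, append_append_comp_leftVars, append_append_comp_rightVars,
    Subsingleton.elim (id ∘ Empty.elim) (Empty.elim : Empty → N.Home)]

/-- Dummy variables do not affect the relation `x ∼_{t,D} y`: the tuple `z` may be embedded into a
longer one. -/
theorem StandardStructure.SimTerm.of_map (N : StandardStructure.{u, v, w, e, h} X L E)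
    [Nonempty N.Home] {n l l' : ℕ} {t : STerm X L E Empty (n + l) 0} {f : Fin l → Fin l'}
    (hf : Function.Injective f) {D : Set (X × X)} {a b : Fin n → N.Home}
    (H : N.SimTerm (t.map (Fin.append (Fin.castAdd l') (Fin.natAdd n ∘ f)) id) D a b) :
    N.SimTerm t D a b := by
  intro z
  have key : ∀ a : Fin n → N.Home,
      Fin.append a (Function.extend f z fun _ => Classical.arbitrary _) ∘
        Fin.append (Fin.castAdd l') (Fin.natAdd n ∘ f) = Fin.append a z := by
    intro a
    ext i
    refine Fin.addCases (fun i => ?_) (fun i => ?_) i <;> simp [hf.extend_apply]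
  have := H (Function.extend f z fun _ => Classical.arbitrary _)
  rwa [STerm.eval_map, STerm.eval_map, key, key] at this

/-- The filter of those relations between `n`-tuples that contain a relation `x ∼_{t,D} y`, for some
finite nonempty tuple `t` of terms and tuple `D` of closed neighbourhoods of the diagonal. -/
def simFilter [Nonempty X] (N : StandardStructure.{u, v, w, e, h} X L E) [Nonempty N.Home] (n : ℕ) :
    Filter ((Fin n → N.Home) × (Fin n → N.Home)) where
  sets := {R | ∃ (k l : ℕ) (t : Fin k → STerm X L E Empty (n + l) 0) (D : Fin k → Set (X × X)),
    0 < k ∧ (∀ i, IsClosed (D i) ∧ Set.diagonal X ⊆ interior (D i)) ∧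
      ∀ x y : Fin n → N.Home, (∀ i, N.SimTerm (t i) (D i) x y) → (x, y) ∈ R}
  -- The tuple of terms has to be nonempty: a constant term, with `D` the whole space.
  univ_sets := ⟨1, 0, fun _ => .func (k := 0) (ContinuousMap.const _ (Classical.arbitrary X))
    Fin.elim0, fun _ => Set.univ, one_pos, by simp, fun _ _ _ => trivial⟩
  sets_of_superset := by
    rintro R R' ⟨k, l, t, D, hk, hD, H⟩ hR
    exact ⟨k, l, t, D, hk, hD, fun x y hxy => hR (H x y hxy)⟩
  -- The two tuples of terms are concatenated, with the concatenation of their tuples `z`.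
  inter_sets := by
    rintro R₁ R₂ ⟨k₁, l₁, t₁, D₁, hk₁, hD₁, H₁⟩ ⟨k₂, l₂, t₂, D₂, hk₂, hD₂, H₂⟩
    refine ⟨k₁ + k₂, l₁ + l₂, Fin.append
      (fun i => (t₁ i).map (Fin.append (Fin.castAdd _) (Fin.natAdd n ∘ Fin.castAdd l₂)) id)
      (fun i => (t₂ i).map (Fin.append (Fin.castAdd _) (Fin.natAdd n ∘ Fin.natAdd l₁)) id),
      Fin.append D₁ D₂, by omega, fun i => ?_, fun x y H => ⟨H₁ x y fun i => ?_, H₂ x y fun i => ?_⟩⟩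
    · refine Fin.addCases (fun i => ?_) (fun i => ?_) i
      · simpa using hD₁ i
      · simpa using hD₂ i
    · have := H (Fin.castAdd k₂ i)
      rw [Fin.append_left, Fin.append_left] at this
      exact this.of_map N (Fin.castAdd_injective _ _)
    · have := H (Fin.natAdd k₁ i)
      rw [Fin.append_right, Fin.append_right] at this
      exact this.of_map N (Fin.natAdd_injective _ _)

theorem eventually_simFilter_iff [Nonempty X] (N : StandardStructure.{u, v, w, e, h} X L E)
    [Nonempty N.Home] {n : ℕ} {R : (Fin n → N.Home) → (Fin n → N.Home) → Prop} :
    (∀ᶠ q in simFilter N n, R q.1 q.2) ↔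
      ∃ (k l : ℕ) (t : Fin k → STerm X L E Empty (n + l) 0) (D : Fin k → Set (X × X)),
        0 < k ∧ (∀ i, IsClosed (D i) ∧ Set.diagonal X ⊆ interior (D i)) ∧
          ∀ x y : Fin n → N.Home, (∀ i, N.SimTerm (t i) (D i) x y) → R x y :=
  Iff.rfl

theorem eventually_simTerm [Nonempty X] (N : StandardStructure.{u, v, w, e, h} X L E)
    [Nonempty N.Home] {n l : ℕ} (t : STerm X L E Empty (n + l) 0) {D : Set (X × X)}
    (hD : IsClosed D) (hD' : Set.diagonal X ⊆ interior D) :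
    ∀ᶠ q in simFilter N n, N.SimTerm t D q.1 q.2 :=
  (eventually_simFilter_iff N (R := N.SimTerm t D)).2
    ⟨1, l, fun _ => t, fun _ => D, one_pos, fun _ => ⟨hD, hD'⟩, fun _ _ H => H 0⟩

theorem StandardStructure.simS_of_forall_closed_nhds [CompactSpace X] [T2Space X]
    (N : StandardStructure.{u, v, w, e, h} X L E) {n : ℕ} {a b : Fin n → N.Home}
    (H : ∀ (l : ℕ) (t : STerm X L E Empty (n + l) 0) (D : Set (X × X)), IsClosed D →
      Set.diagonal X ⊆ interior D → N.SimTerm t D a b) : N.SimS a b :=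
  fun l t z => mem_of_forall_closed_nhds isClosed_diagonal fun D hD hD' => H l t D hD hD' z

/-- A formula of `𝓕` that is consistent with every relation of `simFilter` is realized by some
`x, y` with `x ∼_S y`. -/
theorem StandardStructure.IsFSaturated.exists_simS [CompactSpace X] [T2Space X] [Nonempty X]
    {U : StandardStructure.{u, v, w, e, h} X L E} (hU : U.IsFSaturated) [Infinite U.Home]
    {n : ℕ} (χ : U.Formula (n + n) 0)
    (H : ∃ᶠ q in simFilter U n, U.Sat χ (Fin.append q.1 q.2) Fin.elim0) :
    ∃ a b : Fin n → U.Home, U.SimS a b ∧ U.Sat χ (Fin.append a b) Fin.elim0 := by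
  let T : Set (U.Formula (n + n) 0) := {ψ | ∃ (l : ℕ) (t : STerm X L E Empty (n + l) 0)
    (D : TopologicalSpace.Closeds (X × X)),
      Set.diagonal X ⊆ interior (D : Set (X × X)) ∧ ψ = simFormula t D}
  have hcard : #(⋃ ψ ∈ insert χ T, ψ.params : Set U.Home) < #U.Home := by
    refine lt_of_lt_of_le (Cardinal.lt_aleph0_iff_set_finite.2 (χ.finite_params.subset ?_))
      (Cardinal.aleph0_le_mk U.Home)
    refine Set.iUnion₂_subset fun ψ hψ => ?_
    rcases hψ with rfl | ⟨l, t, D, -, rfl⟩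
    · exact subset_rfl
    · rw [params_simFormula]
      exact Set.empty_subset _
  have hfin : ∀ T₀ ⊆ insert χ T, T₀.Finite →
      ∃ a α, ∀ ψ ∈ T₀, U.Sat ψ a α := by
    intro T₀ hT₀ hfin
    have ev : ∀ ψ ∈ T₀, ∀ᶠ q in simFilter U n, U.Sat χ (Fin.append q.1 q.2) Fin.elim0 →
        U.Sat ψ (Fin.append q.1 q.2) Fin.elim0 := by
      intro ψ hψ
      rcases hT₀ hψ with rfl | ⟨l, t, D, hD, rfl⟩
      · exact Eventually.of_forall fun _ h => h
      · filter_upwards [eventually_simTerm U t D.isClosed hD] with q hq _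
        exact (sat_simFormula U t D _ _).2 hq
    obtain ⟨q, hχ, hq⟩ := (H.and_eventually ((eventually_all_finite hfin).2 ev)).exists
    exact ⟨_, Fin.elim0, fun ψ hψ => hq ψ hψ hχ⟩
  obtain ⟨q, α, hq⟩ := hU (n + n) 0 (insert χ T) hcard hfin
  have hq' : Fin.append (fun i => q (Fin.castAdd n i)) (fun i => q (Fin.natAdd n i)) = q :=
    Fin.append_castAdd_natAdd
  rw [Subsingleton.elim α Fin.elim0, ← hq'] at hq
  refine ⟨_, _, U.simS_of_forall_closed_nhds fun l t D hD hD' => ?_, hq χ (Set.mem_insert _ _)⟩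
  exact (sat_simFormula U t ⟨D, hD⟩ _ _).1
    (hq _ (Set.mem_insert_of_mem _ ⟨l, t, ⟨D, hD⟩, hD', rfl⟩))

end

end TwoSorted

/-! ### The perturbation lemma -/

open TwoSorted in
theorem mainTheorem11
    {X : Type w} [TopologicalSpace X] [CompactSpace X] [T2Space X] [Nonempty X]
    {L : FirstOrder.Language.{u, v}} {E : ℕ → Type e}
    (U : TwoSorted.StandardStructure.{u, v, w, e, h} X L E)
    (hU : U.IsFSaturated) (hInf : Infinite U.Home)
    {n : ℕ} (φ : U.Formula n 0) :
    U.IsSimSInvariant φ ↔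
      ∀ φ' : U.Formula n 0, TwoSorted.FFormula.Approx φ φ' →
        ∃ (k l : ℕ) (t : Fin k → TwoSorted.STerm X L E Empty (n + l) 0)
          (D : Fin k → Set (X × X)),
          0 < k ∧
          (∀ i, IsClosed (D i) ∧ Set.diagonal X ⊆ interior (D i)) ∧
          ∀ x y : Fin n → U.Home,
            (∀ i, U.SimTerm (t i) (D i) x y) → U.Sat φ x Fin.elim0 →
              U.Sat φ' y Fin.elim0 := by
  constructor
  · intro hinv φ' hφ'
    refine (eventually_simFilter_iff U
      (R := fun x y => U.Sat φ x Fin.elim0 → U.Sat φ' y Fin.elim0)).1 ?_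
    by_contra hev
    obtain ⟨ψ, hψ⟩ := hφ'.exists_separating U id
    -- The formula `φ(x) ∧ ψ(y)` in the `n + n` variables `x, y`.
    have hfreq : ∃ᶠ q in simFilter U n, U.Sat
        (.and (φ.rename (Fin.castAdd n)) (ψ.rename (Fin.natAdd n)))
        (Fin.append q.1 q.2) Fin.elim0 := by
      refine (Filter.not_eventually.1 hev).mono fun q hq => ?_
      obtain ⟨h₁, h₂⟩ := Classical.not_imp.1 hq
      refine ⟨?_, ?_⟩
      · rw [FFormula.realize_rename, append_comp_castAdd]
        exact h₁
      · rw [FFormula.realize_rename, append_comp_natAdd]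
        exact (hψ _ _).2 h₂
    obtain ⟨a, b, hab, hsat⟩ := hU.exists_simS _ hfreq
    obtain ⟨h₁, h₂⟩ := hsat
    rw [FFormula.realize_rename, append_comp_castAdd] at h₁
    rw [FFormula.realize_rename, append_comp_natAdd] at h₂
    exact (hψ b Fin.elim0).1 ((hinv a b hab).1 h₁) h₂
  · intro H
    have key : ∀ a b : Fin n → U.Home, U.SimS a b → U.Sat φ a Fin.elim0 →
        U.Sat φ b Fin.elim0 := by
      intro a b hab ha
      refine hU.sat_of_forall_approx hInf φ b _ fun φ' hφ' => ?_
      obtain ⟨k, l, t, D, -, hD, hR⟩ := H φ' hφ'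
      exact hR a b (fun i z => interior_subset ((hD i).2 (hab l (t i) z))) ha
    exact fun a b hab => ⟨key a b hab, key b a fun l t z => (hab l t z).symm⟩
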